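/- A \emph{range set} is a set $R\subseteq[0,\infty)$ with $0\in R$. A metric space is \emph{$R$-valued} if all its distances belong to $R$. It is \emph{$\mathcal N(R)$-injective} if it is non-empty and, for every finite $R$-valued ultrametric space $Z$ and every subspace $Y\subseteq Z$, every isometric embedding of $Y$ into it extends to an isometric embedding of $Z$. A set $S\subseteq[0,\infty)$ is \emph{tenuous} if it is finite or of the form $\{0\}\cup\{a_i : i\ge 0\}$ with $(a_i)_{i\ge 0}$ a strictly decreasing sequence of positive reals tending to $0$. Let $\mathcal T(R)$ be the set of all tenuous range sets $S\subseteq R$. An \emph{$R$-petal} of a metric space $(X,d)$ is a family $\{P(S)\}_{S\in\mathcal T(R)}$ of subspaces of $X$ such that: \begin{enumerate} \item[(P1)] for every $S\in\mathcal T(R)$ with $S\ne\{0\}$, the space $(P(S),d)$ is a separable complete $\mathcal N(S)$-injective $S$-valued ultrametric space; \item[(P2)] $\bigcup_{S\in\mathcal T(R)}P(S)=X$; \item[(P3)] $P(S)\cap P(T)=P(S\cap T)$ for all $S,T\in\mathcal T(R)$; \item[(P4)] for all $S,T\in\mathcal T(R)$ and $x\in P(T)$, the distance $d(x,P(S))=\inf_{p\in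 P(S)}d(x,p)$ (with $\inf\emptyset=\infty$) belongs to $\{0\}\cup(T\setminus S)$. \end{enumerate} For uncountable $R$, an \emph{$R$-petaloid space} is an $R$-valued ultrametric space that has an $R$-petal. An ultrametric space is \emph{the $R$-Urysohn universal ultrametric space} if either $R$ is finite or countable and the space is separable, complete, $\mathcal N(R)$-injective and $R$-valued, or $R$ is uncountable and the space is $R$-petaloid. \textbf{Theorem.} Let $R$ be a range set and let $(X,d)$ be the $R$-Urysohn universal ultrametric space. Equip $X\times X$ with the metric $(d\times_\infty d)((x,y),(u,v))=\max\{d(x,u),d(y,v)\}$. Then $(X\times X,d\times_\infty d)$ is also the $R$-Urysohn universal ultrametric space; in particular, it is isometric to $(X,d)$. Moreover, if $R$ is uncountable and $\{P(S)\}_{S\in\mathcal T(R)}$ is any $R$-petal of $X$, then $\{P(S)\times P(S)\}_{S\in\mathcal T(R)}$ is an $R$-petal of $(X\times X,d\times_\infty d)$. -/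

import Mathlib

/-- A range set: a set of nonnegative reals containing `0`. -/
def IsRangeSet (R : Set ℝ) : Prop :=
  R ⊆ Set.Ici 0 ∧ (0 : ℝ) ∈ R

/-- All distances of the metric space `X` belong to `R`. -/
def IsValuedIn (R : Set ℝ) (X : Type*) [MetricSpace X] : Prop :=
  ∀ x y : X, dist x y ∈ R

/-- Injectivity of `X` for the class of all finite `R`-valued ultrametric spaces: `X` is nonempty
and every isometric embedding into `X` of a subspace `Y` of such a space `Z` extends to an isometric
embedding of `Z`. Every finite space has an isometric copy in `Type`. -/
def IsFiniteInjective (R : Set ℝ) (X : Type*) [MetricSpace X] : Prop :=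
  Nonempty X ∧
    ∀ (Z : Type) [MetricSpace Z], Finite Z → IsUltrametricDist Z → IsValuedIn R Z →
      ∀ (Y : Set Z) (f : Y → X), Isometry f →
        ∃ g : Z → X, Isometry g ∧ ∀ y : Y, g y = f y

/-- Separable complete `R`-valued ultrametric spaces that are injective for the finite `R`-valued
ultrametric spaces. For finite or countable `R` this is the `R`-Urysohn universal space. -/
structure IsSeparableUrysohn (R : Set ℝ) (X : Type*) [MetricSpace X] : Prop where
  ultrametric : IsUltrametricDist X
  valued : IsValuedIn R X
  separable : TopologicalSpace.SeparableSpace X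
  complete : CompleteSpace X
  injective : IsFiniteInjective R X

/-- `E = {0} ∪ {a₀, a₁, …}` for a strictly decreasing sequence of positive reals tending to `0`. -/
def IsSemiSporadic (E : Set ℝ) : Prop :=
  ∃ a : ℕ → ℝ, StrictAnti a ∧ (∀ i, 0 < a i) ∧
    Filter.Tendsto a Filter.atTop (nhds 0) ∧ E = {0} ∪ Set.range a

/-- A tenuous set: finite or semi-sporadic. -/
def IsTenuous (E : Set ℝ) : Prop :=
  E.Finite ∨ IsSemiSporadic E

/-- The set of all tenuous range sets contained in `R`. -/
def tenuousSubsets (R : Set ℝ) : Set (Set ℝ) :=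
  {S | IsRangeSet S ∧ IsTenuous S ∧ S ⊆ R}

/-- `P` is an `R`-petal of `X`. Only the pieces `P S` with `S ∈ tenuousSubsets R` matter. -/
structure IsPetal (R : Set ℝ) {X : Type*} [MetricSpace X] (P : Set ℝ → Set X) : Prop where
  urysohn : ∀ S ∈ tenuousSubsets R, S ≠ {0} → IsSeparableUrysohn S (P S)
  cover : ⋃ S ∈ tenuousSubsets R, P S = Set.univ
  inter : ∀ S ∈ tenuousSubsets R, ∀ T ∈ tenuousSubsets R, P S ∩ P T = P (S ∩ T)
  /-- The distance to a set is the infimum of the distances to its points, which is infinite for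
  the empty set; `Metric.infDist` returns `0` there, so nonemptiness of `P S` is spelled out. -/
  distance : ∀ S ∈ tenuousSubsets R, ∀ T ∈ tenuousSubsets R, ∀ x ∈ P T,
    (P S).Nonempty ∧ Metric.infDist x (P S) ∈ {0} ∪ (T \ S)

/-- `R`-petaloid spaces (for uncountable `R`): `R`-valued ultrametric spaces with an `R`-petal. -/
structure IsPetaloid (R : Set ℝ) (X : Type*) [MetricSpace X] : Prop where
  ultrametric : IsUltrametricDist X
  valued : IsValuedIn R X
  exists_petal : ∃ P : Set ℝ → Set X, IsPetal R P

/-- `X` is the `R`-Urysohn universal ultrametric space. -/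
def IsUrysohnUniversal (R : Set ℝ) (X : Type*) [MetricSpace X] : Prop :=
  (R.Countable ∧ IsSeparableUrysohn R X) ∨ (¬ R.Countable ∧ IsPetaloid R X)

/-! ### Tenuous sets -/

/-! Stability under squaring rests on a local form of injectivity. In an ultrametric space,
extending finite isometric embeddings only requires that closed balls of radius `r ∈ R`, `r > 0`,
contain arbitrarily many points pairwise at distance at least `r` (`HasEquilateral`), and this
survives products because one factor already supplies the points. Petals pass to squares because the
distance to a rectangle is the maximum of the two coordinate distances (`Metric.infDist_prod`),
hence one of them.

The isometry comes from uniqueness: every `R`-Urysohn universal space is isometric to one model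
depending on `R` alone, the functions `ℝ → ℕ` with tenuous support in `R`, where the distance is the
largest place of disagreement. In each closed ball of radius `r` the open `r`-balls form a countably
infinite family; they are numbered so that a distinguished one gets `0`, and the coordinate of `x`
at `r` is the number of its open ball. The distinguished balls must be chosen coherently
(`IsCenterSystem`), so that supports are tenuous and every tenuous function occurs. In the separable
case the distinguished ball is found from the first term of a dense sequence lying in the closed
ball; in the petaloid case it consists of the points lying in some `P S` with `r ∉ S`. -/

theorem IsTenuous.finite_inter_Ici {E : Set ℝ} (hE : IsTenuous E) {ε : ℝ} (hε : 0 < ε) :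
    (E ∩ Set.Ici ε).Finite := by
  rcases hE with hE | ⟨a, -, -, ha, rfl⟩
  · exact hE.inter_of_left _
  · obtain ⟨N, hN⟩ := Filter.eventually_atTop.1 (ha.eventually (gt_mem_nhds hε))
    refine ((Set.finite_Iio N).image a).subset ?_
    rintro x ⟨rfl | ⟨n, rfl⟩, hx⟩
    · exact absurd hx (not_le.2 hε)
    · refine ⟨n, ?_, rfl⟩
      by_contra h
      exact absurd (hN n (not_lt.1 h)) (not_lt.2 hx)

/-- If infinite, the set of positive elements with reversed order is locally finite with a least and
no greatest element, hence order isomorphic to `ℕ`. With this criterion, closure of tenuous sets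
under unions and subsets is immediate. -/
theorem isTenuous_of_finite_inter_Ici {E : Set ℝ} (hE : IsRangeSet E)
    (hfin : ∀ ε, 0 < ε → (E ∩ Set.Ici ε).Finite) : IsTenuous E := by
  by_cases hE' : E.Finite
  · exact Or.inl hE'
  right
  let F : Set ℝ := E \ {0}
  have hFpos : ∀ x ∈ F, 0 < x := fun x hx => lt_of_le_of_ne (hE.1 hx.1) (Ne.symm hx.2)
  have hFinf : F.Infinite := Set.Infinite.sdiff hE' (Set.finite_singleton 0)
  have hFfin : ∀ ε : ℝ, 0 < ε → {x : F | ε ≤ x}.Finite := fun ε hε =>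
    Set.Finite.of_finite_image (f := Subtype.val)
      ((hfin ε hε).subset (by rintro _ ⟨x, hx, rfl⟩; exact ⟨x.2.1, hx⟩))
      Subtype.val_injective.injOn
  have : Infinite F := hFinf.to_subtype
  let ι := (F)ᵒᵈ
  obtain ⟨x₀⟩ : Nonempty F := inferInstance
  obtain ⟨m, hm⟩ : ∃ m : F, ∀ x : F, x ≤ m := by
    obtain ⟨m, hm, hmax⟩ := Set.exists_max_image {x : F | (x₀ : ℝ) ≤ x} id
      (hFfin x₀ (hFpos _ x₀.2)) ⟨x₀, le_refl (x₀ : ℝ)⟩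
    refine ⟨m, fun x => ?_⟩
    rcases le_total (x₀ : ℝ) x with h | h
    · exact hmax x h
    · exact le_trans (show x ≤ x₀ from h) (show x₀ ≤ m from hm)
  let _ : OrderBot ι := { bot := OrderDual.toDual m, bot_le := fun x => hm (OrderDual.ofDual x) }
  let _ : LocallyFiniteOrder ι := LocallyFiniteOrder.ofFiniteIcc fun a b =>
    (hFfin (OrderDual.ofDual b : F) (hFpos _ (OrderDual.ofDual b).2)).subset fun x hx => hx.2
  have : NoMaxOrder ι := ⟨fun a => by
    by_contra! h
    refine Set.infinite_univ (α := F) ?_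
    exact (hFfin (OrderDual.ofDual a : F) (hFpos _ (OrderDual.ofDual a).2)).subset
      fun x _ => not_lt.1 (h (OrderDual.toDual x))⟩
  let _ : SuccOrder ι := LinearLocallyFiniteOrder.succOrder ι
  let _ : PredOrder ι := LinearLocallyFiniteOrder.predOrder ι
  let e : ι ≃o ℕ := orderIsoNatOfLinearSuccPredArch
  let a : ℕ → ℝ := fun n => ((OrderDual.ofDual (e.symm n) : F) : ℝ)
  have ha : StrictAnti a := fun i j hij => e.symm.strictMono hij
  have hpos : ∀ i, 0 < a i := fun i => hFpos _ (OrderDual.ofDual (e.symm i)).2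
  refine ⟨a, ha, hpos, ?_, ?_⟩
  · rw [Metric.tendsto_atTop]
    intro ε hε
    obtain ⟨N, hN⟩ : ∃ N, a N < ε := by
      by_contra! h
      refine Set.infinite_univ (α := F) ((hFfin ε hε).subset fun x _ => ?_)
      simpa [a] using h (e (OrderDual.toDual x))
    refine ⟨N, fun n hn => ?_⟩
    rw [Real.dist_eq, sub_zero, abs_of_pos (hpos n)]
    exact (ha.antitone hn).trans_lt hN
  · ext x
    constructor
    · intro hx
      by_cases h0 : x = 0
      · exact Or.inl h0
      · exact Or.inr ⟨e (OrderDual.toDual ⟨x, hx, h0⟩), by simp [a]⟩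
    · rintro (rfl | ⟨n, rfl⟩)
      · exact hE.2
      · exact (OrderDual.ofDual (e.symm n)).2.1

theorem mem_tenuousSubsets {R S : Set ℝ} :
    S ∈ tenuousSubsets R ↔
      IsRangeSet S ∧ (∀ ε, 0 < ε → (S ∩ Set.Ici ε).Finite) ∧ S ⊆ R :=
  ⟨fun h => ⟨h.1, fun _ => h.2.1.finite_inter_Ici, h.2.2⟩,
    fun h => ⟨h.1, isTenuous_of_finite_inter_Ici h.1 h.2.1, h.2.2⟩⟩

theorem tenuousSubsets_mono {R S T : Set ℝ} (hS : S ∈ tenuousSubsets R) (hTS : T ⊆ S)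
    (h0 : (0 : ℝ) ∈ T) : T ∈ tenuousSubsets R := by
  rw [mem_tenuousSubsets] at *
  exact ⟨⟨hTS.trans hS.1.1, h0⟩,
    fun ε hε => (hS.2.1 ε hε).subset (Set.inter_subset_inter_left _ hTS), hTS.trans hS.2.2⟩

theorem union_mem_tenuousSubsets {R S T : Set ℝ} (hS : S ∈ tenuousSubsets R)
    (hT : T ∈ tenuousSubsets R) : S ∪ T ∈ tenuousSubsets R := by
  rw [mem_tenuousSubsets] at *
  refine ⟨⟨Set.union_subset hS.1.1 hT.1.1, Or.inl hS.1.2⟩, fun ε hε => ?_,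
    Set.union_subset hS.2.2 hT.2.2⟩
  rw [Set.union_inter_distrib_right]
  exact (hS.2.1 ε hε).union (hT.2.1 ε hε)

theorem pair_mem_tenuousSubsets {R : Set ℝ} (hR : IsRangeSet R) {r : ℝ} (hr : r ∈ R) :
    {0, r} ∈ tenuousSubsets R := by
  have h : ({0, r} : Set ℝ) ⊆ R := Set.insert_subset hR.2 (Set.singleton_subset_iff.2 hr)
  exact ⟨⟨h.trans hR.1, Or.inl rfl⟩, Or.inl (Set.toFinite _), h⟩

theorem insert_mem_tenuousSubsets {R S : Set ℝ} (hR : IsRangeSet R) (hS : S ∈ tenuousSubsets R)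
    {r : ℝ} (hr : r ∈ R) : insert r S ∈ tenuousSubsets R := by
  have := union_mem_tenuousSubsets (pair_mem_tenuousSubsets hR hr) hS
  exact tenuousSubsets_mono this (by intro x; simp; tauto) (Or.inr hS.1.2)

/-! ### Equilateral families and injectivity -/

/-- Every ball of radius `r ∈ R` contains arbitrarily large finite families of points that are
pairwise at distance at least `r`. -/
def HasEquilateral (R : Set ℝ) (X : Type*) [MetricSpace X] : Prop :=
  ∀ (x : X), ∀ r ∈ R, 0 < r → ∀ n : ℕ, ∃ g : Fin n → X,
    (∀ i, dist x (g i) ≤ r) ∧ ∀ i j, i ≠ j → r ≤ dist (g i) (g j)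

/-- The metric space on `α` all of whose nonzero distances are equal to `r`. -/
@[reducible] noncomputable def equilateralMetric (α : Type) [DecidableEq α] (r : ℝ) (hr : 0 < r) :
    MetricSpace α where
  dist i j := if i = j then 0 else r
  dist_self i := by simp
  dist_comm i j := by simp [eq_comm]
  dist_triangle i j k := by
    by_cases h : i = j <;> by_cases h' : j = k <;> by_cases h'' : i = k <;>
      simp_all [hr.le]
  eq_of_dist_eq_zero {i j} h := by
    by_contra hij
    simp only [if_neg hij] at h
    exact hr.ne' h

theorem IsFiniteInjective.hasEquilateral {R : Set ℝ} (hR : IsRangeSet R) {X : Type*}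
    [MetricSpace X] (hX : IsFiniteInjective R X) : HasEquilateral R X := by
  intro x r hr hr0 n
  -- The extra point `0` is pinned at `x`; the other `n` points become the family.
  let _ : MetricSpace (Fin (n + 1)) := equilateralMetric (Fin (n + 1)) r hr0
  have hd : ∀ i j : Fin (n + 1), dist i j = if i = j then 0 else r := fun _ _ => rfl
  obtain ⟨g, hg, hgx⟩ := hX.2 (Fin (n + 1)) inferInstance
    ⟨fun i j k => by
      simp only [hd]
      by_cases h : i = j <;> by_cases h' : j = k <;> by_cases h'' : i = k <;>
        simp_all [hr0.le]⟩
    (fun i j => by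
      rw [hd]
      split_ifs
      exacts [hR.2, hr])
    {0} (fun _ => x) (fun a b => by
      rw [Subsingleton.elim a b]; simp)
  have h0 : g 0 = x := hgx ⟨0, rfl⟩
  refine ⟨fun i => g i.succ, fun i => ?_, fun i j hij => ?_⟩
  · rw [← h0, hg.dist_eq, hd]
    split_ifs
    exacts [hr0.le, le_rfl]
  · rw [hg.dist_eq, hd, if_neg (by simpa using hij)]

/-- Pigeonhole: among `A.card + 1` points pairwise at distance at least `r`, no two can be closer
than `r` to the same element of `A`. -/
theorem HasEquilateral.exists_far {R : Set ℝ} {X : Type*} [MetricSpace X] [IsUltrametricDist X]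
    (hX : HasEquilateral R X) (x : X) {r : ℝ} (hr : r ∈ R) (hr0 : 0 < r) (A : Finset X) :
    ∃ q, dist x q ≤ r ∧ ∀ a ∈ A, r ≤ dist q a := by
  obtain ⟨g, hg, hgd⟩ := hX x r hr hr0 (A.card + 1)
  by_contra! h
  choose a ha had using fun i => h (g i) (hg i)
  obtain ⟨i, -, j, -, hij, hija⟩ := Finset.exists_ne_map_eq_of_card_lt_of_maps_to
    (s := Finset.univ) (t := A) (f := a) (by simp) (fun i _ => ha i)
  have h1 := IsUltrametricDist.dist_triangle_max (g i) (a i) (g j)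
  have h2 := had i
  have h3 := had j
  rw [← hija, dist_comm] at h3
  exact absurd (hgd i j hij) (not_le.2 (h1.trans_lt (max_lt h2 h3)))

theorem HasEquilateral.isFiniteInjective {R : Set ℝ} {X : Type*} [MetricSpace X]
    [IsUltrametricDist X] [hne : Nonempty X] (hX : HasEquilateral R X) : IsFiniteInjective R X := by
  classical
  refine ⟨hne, fun Z _ hZ hZu hZR Y f hf => ?_⟩
  have := Fintype.ofFinite Z
  obtain ⟨x₀⟩ := hne
  suffices h : ∀ t : Finset Z, ∃ g : Z → X, (∀ y : Y, g y = f y) ∧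
      ∀ a b, (a ∈ Y ∨ a ∈ t) → (b ∈ Y ∨ b ∈ t) → dist (g a) (g b) = dist a b by
    obtain ⟨g, hg, hgd⟩ := h Finset.univ
    exact ⟨g, Isometry.of_dist_eq fun a b => hgd a b (by simp) (by simp), hg⟩
  intro t
  induction t using Finset.induction_on with
  | empty =>
    refine ⟨fun z => if h : z ∈ Y then f ⟨z, h⟩ else x₀, fun y => by simp, ?_⟩
    rintro a b (ha | ha) (hb | hb)
    · simp [ha, hb, hf.dist_eq, Subtype.dist_eq]
    all_goals simp at *
  | insert z t _ ih =>
    obtain ⟨g, hg, hgd⟩ := ih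
    by_cases hz : z ∈ Y ∨ z ∈ t
    · refine ⟨g, hg, fun a b ha hb => hgd a b ?_ ?_⟩
      · rcases ha with ha | ha
        · exact Or.inl ha
        · rcases Finset.mem_insert.1 ha with rfl | ha
          exacts [hz, Or.inr ha]
      · rcases hb with hb | hb
        · exact Or.inl hb
        · rcases Finset.mem_insert.1 hb with rfl | hb
          exacts [hz, Or.inr hb]
    let W : Finset Z := Finset.univ.filter fun a => a ∈ Y ∨ a ∈ t
    have hW : ∀ a, a ∈ W ↔ a ∈ Y ∨ a ∈ t := by simp [W]
    -- Let `y` be a placed point nearest to `z`, at distance `r`. The ultrametric inequality then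
    -- determines all distances from `z`, so it is enough that `q` lies within `r` of `g y` and no
    -- closer than `r` to any placed image.
    have key : ∃ q : X, ∀ a ∈ W, dist q (g a) = dist z a := by
      rcases W.eq_empty_or_nonempty with hWe | hWn
      · exact ⟨x₀, by simp [hWe]⟩
      obtain ⟨y, hy, hmin⟩ := W.exists_min_image (fun a => dist z a) hWn
      have hzy : 0 < dist z y := dist_pos.2 fun h => hz ((hW z).1 (h ▸ hy))
      obtain ⟨q, hq, hqA⟩ := hX.exists_far (g y) (hZR z y) hzy (W.image g)
      refine ⟨q, fun a ha => ?_⟩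
      have hga := hqA (g a) (Finset.mem_image_of_mem g ha)
      have hgy := hqA (g y) (Finset.mem_image_of_mem g hy)
      have hza := hmin a ha
      have hya := hgd y a ((hW y).1 hy) ((hW a).1 ha)
      rw [dist_comm] at hq
      have hqy : dist q (g y) = dist z y := le_antisymm hq hgy
      rcases le_or_gt (dist y a) (dist z y) with h | h
      · have h1 := IsUltrametricDist.dist_triangle_max q (g y) (g a)
        have h2 := IsUltrametricDist.dist_triangle_max z y a
        rw [hya, hqy, max_eq_left h] at h1
        rw [max_eq_left h] at h2
        rw [le_antisymm h1 hga, le_antisymm h2 hza]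
      · rw [IsUltrametricDist.dist_eq_max_of_dist_ne_dist q (g y) (g a)
          (by rw [hqy, hya]; exact h.ne),
          IsUltrametricDist.dist_eq_max_of_dist_ne_dist z y a h.ne, hqy, hya]
    obtain ⟨q, hq⟩ := key
    have hne : ∀ a, a ∈ Y ∨ a ∈ t → a ≠ z := fun a ha h => hz (h ▸ ha)
    refine ⟨Function.update g z q, fun y => ?_, fun a b ha hb => ?_⟩
    · rw [Function.update_of_ne (hne y (Or.inl y.2)), hg]
    · have hor : ∀ a, (a ∈ Y ∨ a ∈ insert z t) → a = z ∨ (a ∈ Y ∨ a ∈ t) := by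
        intro a ha
        simp only [Finset.mem_insert] at ha
        tauto
      rcases hor a ha with rfl | ha <;> rcases hor b hb with h | hb
      · rw [h]; simp
      · rw [Function.update_self, Function.update_of_ne (hne b hb), hq b ((hW b).2 hb)]
      · rw [h, Function.update_self, Function.update_of_ne (hne a ha), dist_comm,
          hq a ((hW a).2 ha), dist_comm]
      · rw [Function.update_of_ne (hne b hb), Function.update_of_ne (hne a ha), hgd a b ha hb]

theorem HasEquilateral.prod {R : Set ℝ} {X Y : Type*} [MetricSpace X] [MetricSpace Y]
    (hX : HasEquilateral R X) : HasEquilateral R (X × Y) := by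
  intro p r hr hr0 n
  obtain ⟨g, hg, hgd⟩ := hX p.1 r hr hr0 n
  refine ⟨fun i => (g i, p.2), fun i => ?_, fun i j hij => ?_⟩
  · simpa [Prod.dist_eq, hr0.le] using hg i
  · exact (hgd i j hij).trans (le_max_left _ _)

theorem IsUltrametricDist.prod {X Y : Type*} [MetricSpace X] [MetricSpace Y]
    [IsUltrametricDist X] [IsUltrametricDist Y] : IsUltrametricDist (X × Y) := by
  refine ⟨fun x y z => ?_⟩
  simp only [Prod.dist_eq]
  have h1 := IsUltrametricDist.dist_triangle_max x.1 y.1 z.1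
  have h2 := IsUltrametricDist.dist_triangle_max x.2 y.2 z.2
  refine max_le (h1.trans ?_) (h2.trans ?_)
  · exact max_le_max (le_max_left _ _) (le_max_left _ _)
  · exact max_le_max (le_max_right _ _) (le_max_right _ _)

theorem IsValuedIn.prod {R : Set ℝ} {X Y : Type*} [MetricSpace X] [MetricSpace Y]
    (hX : IsValuedIn R X) (hY : IsValuedIn R Y) : IsValuedIn R (X × Y) := by
  intro x y
  rw [Prod.dist_eq]
  rcases max_choice (dist x.1 y.1) (dist x.2 y.2) with h | h <;> rw [h]
  exacts [hX _ _, hY _ _]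

theorem IsSeparableUrysohn.prod {R : Set ℝ} (hR : IsRangeSet R) {X Y : Type*} [MetricSpace X]
    [MetricSpace Y] (hX : IsSeparableUrysohn R X) (hY : IsSeparableUrysohn R Y) :
    IsSeparableUrysohn R (X × Y) := by
  have := hX.ultrametric
  have := hY.ultrametric
  have := hX.separable
  have := hY.separable
  have := hX.complete
  have := hY.complete
  have := hX.injective.1
  have := hY.injective.1
  have hU : IsUltrametricDist (X × Y) := IsUltrametricDist.prod
  exact ⟨hU, hX.valued.prod hY.valued, inferInstance, inferInstance,
    (hX.injective.hasEquilateral hR).prod.isFiniteInjective⟩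

theorem IsSeparableUrysohn.congr {R : Set ℝ} (hR : IsRangeSet R) {X Y : Type*} [MetricSpace X]
    [MetricSpace Y] (hX : IsSeparableUrysohn R X) (e : X ≃ᵢ Y) : IsSeparableUrysohn R Y := by
  have := hX.ultrametric
  have := hX.separable
  have := hX.complete
  have : Nonempty Y := hX.injective.1.map e
  have hU : IsUltrametricDist Y := ⟨fun x y z => by
    simpa only [e.symm.dist_eq] using
      IsUltrametricDist.dist_triangle_max (e.symm x) (e.symm y) (e.symm z)⟩
  refine ⟨hU, fun x y => by simpa only [e.symm.dist_eq] using hX.valued (e.symm x) (e.symm y),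
    e.surjective.denseRange.separableSpace e.continuous, e.completeSpace_iff.1 inferInstance, ?_⟩
  apply HasEquilateral.isFiniteInjective
  intro x r hr hr0 n
  obtain ⟨g, hg, hgd⟩ := hX.injective.hasEquilateral hR (e.symm x) r hr hr0 n
  refine ⟨fun i => e (g i), fun i => ?_, fun i j hij => ?_⟩
  · rw [← e.symm.dist_eq]; simpa using hg i
  · rw [e.dist_eq]; exact hgd i j hij

theorem Metric.infDist_prod {X Y : Type*} [MetricSpace X] [MetricSpace Y] {A : Set X} {B : Set Y}
    (hA : A.Nonempty) (hB : B.Nonempty) (p : X × Y) :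
    Metric.infDist p (A ×ˢ B) = max (Metric.infDist p.1 A) (Metric.infDist p.2 B) := by
  apply le_antisymm
  · refine le_of_forall_gt fun c hc => ?_
    obtain ⟨a, ha, hac⟩ := (Metric.infDist_lt_iff hA).1 ((le_max_left _ _).trans_lt hc)
    obtain ⟨b, hb, hbc⟩ := (Metric.infDist_lt_iff hB).1 ((le_max_right _ _).trans_lt hc)
    exact (Metric.infDist_lt_iff (hA.prod hB)).2 ⟨(a, b), ⟨ha, hb⟩, max_lt hac hbc⟩
  · refine le_of_forall_gt fun c hc => ?_
    obtain ⟨q, hq, hqc⟩ := (Metric.infDist_lt_iff (hA.prod hB)).1 hc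
    exact max_lt ((Metric.infDist_le_dist_of_mem hq.1).trans_lt ((le_max_left _ _).trans_lt hqc))
      ((Metric.infDist_le_dist_of_mem hq.2).trans_lt ((le_max_right _ _).trans_lt hqc))

/-! ### Petals -/

theorem IsPetal.mono {R : Set ℝ} {X : Type*} [MetricSpace X] {P : Set ℝ → Set X}
    (hP : IsPetal R P) {S T : Set ℝ} (hS : S ∈ tenuousSubsets R) (hT : T ∈ tenuousSubsets R)
    (hST : S ⊆ T) : P S ⊆ P T := by
  have h := hP.inter S hS T hT
  rw [Set.inter_eq_left.2 hST] at h
  exact Set.inter_eq_left.1 h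

theorem IsPetal.exists_mem {R : Set ℝ} {X : Type*} [MetricSpace X] {P : Set ℝ → Set X}
    (hP : IsPetal R P) (x : X) : ∃ S ∈ tenuousSubsets R, x ∈ P S := by
  have h : x ∈ ⋃ S ∈ tenuousSubsets R, P S := by rw [hP.cover]; trivial
  simpa using h

theorem IsPetal.prod {R : Set ℝ} {X : Type*} [MetricSpace X] {P : Set ℝ → Set X}
    (hP : IsPetal R P) : IsPetal R (fun S => P S ×ˢ P S) := by
  refine ⟨fun S hS hS0 => ?_, ?_, fun S hS T hT => ?_, fun S hS T hT x hx => ?_⟩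
  · have h := hP.urysohn S hS hS0
    refine (h.prod hS.1 h).congr hS.1 (IsometryEquiv.mk (Equiv.Set.prod (P S) (P S)).symm ?_)
    exact Isometry.of_dist_eq fun _ _ => rfl
  · refine Set.eq_univ_of_forall fun p => ?_
    obtain ⟨S, hS, hpS⟩ := hP.exists_mem p.1
    obtain ⟨T, hT, hpT⟩ := hP.exists_mem p.2
    have hST := union_mem_tenuousSubsets hS hT
    exact Set.mem_biUnion hST ⟨hP.mono hS hST Set.subset_union_left hpS,
      hP.mono hT hST Set.subset_union_right hpT⟩
  · rw [Set.prod_inter_prod, hP.inter S hS T hT]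
  · obtain ⟨hne, h1⟩ := hP.distance S hS T hT x.1 hx.1
    obtain ⟨-, h2⟩ := hP.distance S hS T hT x.2 hx.2
    refine ⟨hne.prod hne, ?_⟩
    rw [Metric.infDist_prod hne hne]
    rcases max_choice (Metric.infDist x.1 (P S)) (Metric.infDist x.2 (P S)) with h | h <;> rw [h]
    exacts [h1, h2]
open Filter Topology

/-! ### Coordinates on Urysohn universal spaces -/

/-- `N x r` selects in every closed ball of radius `r ∈ R` one open ball of radius `r`, its centre,
in such a way that each point lies outside the centres for few radii only. -/
structure IsCenterSystem (R : Set ℝ) (X : Type*) [MetricSpace X] (N : X → ℝ → Prop) : Prop where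
  of_dist_lt : ∀ x y, ∀ r ∈ R, N x r → dist x y < r → N y r
  dist_lt : ∀ x y, ∀ r ∈ R, 0 < r → N x r → N y r → dist x y ≤ r → dist x y < r
  finite : ∀ x ε, 0 < ε → {r | r ∈ R ∧ ε ≤ r ∧ ¬ N x r}.Finite
  exists_truncation : ∀ x (I : Set ℝ), IsLowerSet I →
    ∃ y, (∀ s ∈ I, s ∈ R → 0 < s → N y s) ∧ (dist x y = 0 ∨ dist x y ∈ I)
  countable : ∀ x, ∀ r ∈ R, 0 < r →
    ∃ D : Set X, D.Countable ∧ ∀ y, dist x y ≤ r → ∃ d ∈ D, dist y d < r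
  equilateral : HasEquilateral R X
  complete : ∀ u : ℕ → X, CauchySeq u → ∀ S ∈ tenuousSubsets R,
    (∀ n, ∀ r ∈ R, 0 < r → ¬ N (u n) r → r ∈ S) → ∃ x, Tendsto u atTop (𝓝 x)

/-- Finitely valued coordinate functions whose support is tenuous and contained in `R`. -/
def tenuousFunctions (R : Set ℝ) : Set (ℝ → ℕ) :=
  {f | (∀ r, f r ≠ 0 → r ∈ R ∧ 0 < r) ∧ ∀ ε, 0 < ε → {r | ε ≤ r ∧ f r ≠ 0}.Finite}

/-- `Φ` identifies `X` with the space of all tenuous functions. -/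
structure IsCoordinateSystem (R : Set ℝ) (X : Type*) [MetricSpace X] (Φ : X → ℝ → ℕ) :
    Prop where
  dist_le_iff : ∀ x y r, 0 ≤ r → (dist x y ≤ r ↔ ∀ s, r < s → Φ x s = Φ y s)
  range_eq : Set.range Φ = tenuousFunctions R

theorem IsCoordinateSystem.injective {R : Set ℝ} {X : Type*} [MetricSpace X] {Φ : X → ℝ → ℕ}
    (hΦ : IsCoordinateSystem R X Φ) : Function.Injective Φ := fun x y h =>
  dist_le_zero.1 ((hΦ.dist_le_iff x y 0 le_rfl).2 fun s _ => congrFun h s)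

/-- Both spaces are copies of `tenuousFunctions R`, and the coordinates determine the distance;
matching equal coordinates is the isometry. -/
theorem IsCoordinateSystem.nonempty_isometryEquiv {R : Set ℝ} {X Y : Type*} [MetricSpace X]
    [MetricSpace Y] {Φ : X → ℝ → ℕ} {Ψ : Y → ℝ → ℕ} (hΦ : IsCoordinateSystem R X Φ)
    (hΨ : IsCoordinateSystem R Y Ψ) : Nonempty (X ≃ᵢ Y) := by
  have h : ∀ x, ∃ y, Ψ y = Φ x := fun x => by
    have : Φ x ∈ Set.range Ψ := by rw [hΨ.range_eq, ← hΦ.range_eq]; exact ⟨x, rfl⟩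
    exact this
  choose F hF using h
  have hiso : Isometry F := by
    have key : ∀ x y r, 0 ≤ r → (dist (F x) (F y) ≤ r ↔ dist x y ≤ r) := fun x y r hr => by
      rw [hΦ.dist_le_iff x y r hr, hΨ.dist_le_iff _ _ r hr, hF, hF]
    exact Isometry.of_dist_eq fun x y => le_antisymm
      ((key x y _ dist_nonneg).2 le_rfl) ((key x y _ dist_nonneg).1 le_rfl)
  have hsurj : Function.Surjective F := fun y => by
    obtain ⟨x, hx⟩ : Ψ y ∈ Set.range Φ := by rw [hΦ.range_eq, ← hΨ.range_eq]; exact ⟨y, rfl⟩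
    exact ⟨x, hΨ.injective ((hF x).trans hx)⟩
  exact ⟨IsometryEquiv.mk (Equiv.ofBijective F ⟨hiso.injective, hsurj⟩) hiso⟩

/-- A countable infinite quotient admits a labelling by natural numbers with a prescribed class
labelled `0`. -/
theorem exists_label {B : Type*} [s : Setoid B] [Countable (Quotient s)] [Infinite (Quotient s)]
    (c : B) : ∃ l : B → ℕ, (∀ y z, l y = l z ↔ y ≈ z) ∧ Function.Surjective l ∧ l c = 0 := by
  obtain ⟨_⟩ := nonempty_denumerable (Quotient s)
  let e : Quotient s ≃ ℕ := (Denumerable.eqv _).trans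
    (Equiv.swap (Denumerable.eqv _ (Quotient.mk s c)) 0)
  exact ⟨fun y => e (Quotient.mk s y), fun y z => by rw [e.injective.eq_iff, Quotient.eq],
    e.surjective.comp Quotient.mk_surjective, by simp [e]⟩

namespace IsCenterSystem

variable {R : Set ℝ} {X : Type*} [MetricSpace X] {N : X → ℝ → Prop}

theorem exists_ball_label [IsUltrametricDist X] (hN : IsCenterSystem R X N) (x : X) {r : ℝ}
    (hr : r ∈ R) (hr0 : 0 < r) :
    ∃ l : X → ℕ, (∀ y z, dist x y ≤ r → dist x z ≤ r → (l y = l z ↔ dist y z < r)) ∧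
      (∀ n, ∃ y, dist x y ≤ r ∧ l y = n) ∧ ∀ y, dist x y ≤ r → (l y = 0 ↔ N y r) := by
  classical
  let B := {y : X // dist x y ≤ r}
  let s : Setoid B :=
    { r := fun y z => dist (y : X) z < r
      iseqv := ⟨fun y => by simpa using hr0, fun {y z} h => by rwa [dist_comm],
        fun {y z w} h h' => (IsUltrametricDist.dist_triangle_max _ _ _).trans_lt (max_lt h h')⟩ }
  obtain ⟨c, hc, hxc⟩ := hN.exists_truncation x (Set.Iic r) (isLowerSet_Iic r)
  have hxc : dist x c ≤ r := by
    rcases hxc with h | h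
    exacts [h ▸ hr0.le, h]
  have hcN : N c r := hc r (Set.mem_Iic.2 le_rfl) hr hr0
  have hcount : Countable (Quotient s) := by
    obtain ⟨D, hD, hDd⟩ := hN.countable x r hr hr0
    have : Countable D := hD
    choose d hd hdist using fun y : B => hDd y y.2
    refine Function.Injective.countable
      (f := fun q : Quotient s => (⟨d q.out, hd _⟩ : D)) fun p q hpq => ?_
    have hpq : d p.out = d q.out := congrArg Subtype.val hpq
    rw [← Quotient.out_eq p, ← Quotient.out_eq q]
    refine Quotient.sound (show dist (p.out : X) q.out < r from ?_)
    have h1 := hdist p.out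
    have h2 := hdist q.out
    rw [← hpq, dist_comm] at h2
    exact (IsUltrametricDist.dist_triangle_max _ _ _).trans_lt (max_lt h1 h2)
  -- An equilateral family with more members than there are classes would put two members in one
  -- class.
  have hinf : Infinite (Quotient s) := by
    by_contra hfin
    rw [not_infinite_iff_finite] at hfin
    have := Fintype.ofFinite (Quotient s)
    obtain ⟨g, hg, hgd⟩ := hN.equilateral x r hr hr0 (Fintype.card (Quotient s) + 1)
    obtain ⟨i, j, hij, h⟩ := Fintype.exists_ne_map_eq_of_card_lt
      (fun i => Quotient.mk s ⟨g i, hg i⟩) (by simp)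
    exact absurd (hgd i j hij) (not_le.2 (Quotient.exact h))
  obtain ⟨l, hl, hls, hl0⟩ := exists_label (B := B) ⟨c, hxc⟩
  have hext : ∀ y (hy : dist x y ≤ r), (if h : dist x y ≤ r then l ⟨y, h⟩ else 0) = l ⟨y, hy⟩ :=
    fun y hy => dif_pos hy
  refine ⟨fun y => if h : dist x y ≤ r then l ⟨y, h⟩ else 0, fun y z hy hz => ?_, fun n => ?_,
    fun y hy => ?_⟩
  · simp only [hext y hy, hext z hz]
    exact hl _ _
  · obtain ⟨y, hy⟩ := hls n
    exact ⟨y, y.2, (hext y y.2).trans hy⟩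
  · simp only [hext y hy]
    rw [← hl0, hl]
    refine ⟨fun h => hN.of_dist_lt c y r hr hcN ?_, fun h => ?_⟩
    · rw [dist_comm]; exact h
    · refine hN.dist_lt y c r hr hr0 h hcN ?_
      rw [dist_comm x y] at hy
      exact (IsUltrametricDist.dist_triangle_max y x c).trans (max_le hy hxc)

theorem exists_label_function [IsUltrametricDist X] (hN : IsCenterSystem R X N) :
    ∃ Φ : X → ℝ → ℕ,
      (∀ x y, ∀ r ∈ R, 0 < r → dist x y ≤ r → (Φ x r = Φ y r ↔ dist x y < r)) ∧
      (∀ x, ∀ r ∈ R, 0 < r → (Φ x r = 0 ↔ N x r)) ∧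
      (∀ x r, Φ x r ≠ 0 → r ∈ R ∧ 0 < r) ∧
      (∀ x, ∀ r ∈ R, 0 < r → ∀ n, ∃ y, dist x y ≤ r ∧ Φ y r = n) := by
  classical
  -- The labelling is chosen per set `B`, not per centre, so that all points of one closed ball use
  -- the same labels.
  have h : ∀ (B : Set X) (r : ℝ), ∃ l : X → ℕ, r ∈ R → 0 < r →
      (∃ x, B = Metric.closedBall x r) → (∀ y ∈ B, ∀ z ∈ B, (l y = l z ↔ dist y z < r)) ∧
      (∀ n, ∃ y ∈ B, l y = n) ∧ ∀ y ∈ B, (l y = 0 ↔ N y r) := by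
    intro B r
    by_cases hB : r ∈ R ∧ 0 < r ∧ ∃ x, B = Metric.closedBall x r
    · obtain ⟨hr, hr0, x, rfl⟩ := hB
      obtain ⟨l, h1, h2, h3⟩ := hN.exists_ball_label x hr hr0
      refine ⟨l, fun _ _ _ => ?_⟩
      simp only [Metric.mem_closedBall']
      exact ⟨fun y hy z hz => h1 y z hy hz, h2, h3⟩
    · exact ⟨fun _ => 0, fun h1 h2 h3 => absurd ⟨h1, h2, h3⟩ hB⟩
  choose l hl using h
  have hΦ : ∀ x, ∀ r, r ∈ R → 0 < r →
      (if r ∈ R ∧ 0 < r then l (Metric.closedBall x r) r x else 0) =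
        l (Metric.closedBall x r) r x := fun x r h1 h2 => if_pos ⟨h1, h2⟩
  refine ⟨fun x r => if r ∈ R ∧ 0 < r then l (Metric.closedBall x r) r x else 0,
    fun x y r hr hr0 hxy => ?_, fun x r hr hr0 => ?_, fun x r => ?_, fun x r hr hr0 n => ?_⟩
  · have hy : y ∈ Metric.closedBall x r := Metric.mem_closedBall'.2 hxy
    simp only [hΦ _ r hr hr0]
    rw [← IsUltrametricDist.closedBall_eq_of_mem hy]
    exact (hl _ r hr hr0 ⟨x, rfl⟩).1 x (Metric.mem_closedBall_self hr0.le) y hy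
  · simp only [hΦ _ r hr hr0]
    exact (hl _ r hr hr0 ⟨x, rfl⟩).2.2 x (Metric.mem_closedBall_self hr0.le)
  · intro h
    by_contra hn
    exact h (if_neg hn)
  · obtain ⟨y, hy, hyn⟩ := (hl _ r hr hr0 ⟨x, rfl⟩).2.1 n
    refine ⟨y, Metric.mem_closedBall'.1 hy, ?_⟩
    simp only [hΦ _ r hr hr0]
    rwa [← IsUltrametricDist.closedBall_eq_of_mem hy]

theorem exists_isCoordinateSystem [IsUltrametricDist X] [hne : Nonempty X] (hR : IsRangeSet R)
    (hXR : IsValuedIn R X) (hN : IsCenterSystem R X N) : ∃ Φ, IsCoordinateSystem R X Φ := by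
  classical
  obtain ⟨Φ, hΦd, hΦN, hΦR, hΦs⟩ := hN.exists_label_function
  have hagree : ∀ x y s, dist x y < s → Φ x s = Φ y s := fun x y s h => by
    by_cases hs : s ∈ R ∧ 0 < s
    · exact (hΦd x y s hs.1 hs.2 h.le).2 h
    · rw [not_not.1 fun h => hs (hΦR x s h), not_not.1 fun h => hs (hΦR y s h)]
  have hdist : ∀ x y r, 0 ≤ r → (dist x y ≤ r ↔ ∀ s, r < s → Φ x s = Φ y s) := by
    refine fun x y r hr => ⟨fun h s hs => hagree x y s (h.trans_lt hs), fun h => ?_⟩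
    by_contra! hlt
    exact lt_irrefl _ ((hΦd x y _ (hXR x y) (hr.trans_lt hlt) le_rfl).1 (h _ hlt))
  have hΦ0 : ∀ x s, (s ∈ R → 0 < s → N x s) → Φ x s = 0 := fun x s h => by
    by_contra h0
    obtain ⟨h1, h2⟩ := hΦR x s h0
    exact h0 ((hΦN x s h1 h2).2 (h h1 h2))
  -- Finitely supported functions are realised from the largest radius down: moving within the
  -- closed `a`-ball sets coordinate `a` and keeps those above, then truncation clears those below.
  have hfinite : ∀ (F : Finset ℝ) (f : ℝ → ℕ), (∀ r, f r ≠ 0 → r ∈ F ∧ r ∈ R ∧ 0 < r) →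
      ∃ x, Φ x = f := by
    intro F
    induction F using Finset.induction_on_min with
    | empty =>
      intro f hf
      obtain ⟨x, hx, -⟩ := hN.exists_truncation hne.some Set.univ isLowerSet_univ
      refine ⟨x, funext fun s => ?_⟩
      rw [hΦ0 x s (hx s trivial)]
      by_contra h
      exact absurd (hf s (Ne.symm h)).1 (Finset.notMem_empty s)
    | insert a F haF ih =>
      intro f hf
      by_cases hfa : f a = 0
      · refine ih f fun r hr => ⟨?_, (hf r hr).2⟩
        rcases Finset.mem_insert.1 (hf r hr).1 with rfl | h
        exacts [absurd hfa hr, h]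
      obtain ⟨-, haR, ha0⟩ := hf a hfa
      obtain ⟨x, hx⟩ := ih (Function.update f a 0) fun r hr => by
        have hra : r ≠ a := by rintro rfl; simp at hr
        rw [Function.update_of_ne hra] at hr
        exact ⟨Finset.mem_of_mem_insert_of_ne (hf r hr).1 hra, (hf r hr).2⟩
      obtain ⟨y, hxy, hya⟩ := hΦs x a haR ha0 (f a)
      obtain ⟨z, hz, hyz⟩ := hN.exists_truncation y (Set.Iio a) (isLowerSet_Iio a)
      have hyz : dist y z < a := by
        rcases hyz with h | h
        exacts [h ▸ ha0, h]
      refine ⟨z, funext fun s => ?_⟩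
      rcases lt_trichotomy s a with hs | rfl | hs
      · rw [hΦ0 z s (hz s hs)]
        by_contra h
        rcases Finset.mem_insert.1 (hf s (Ne.symm h)).1 with h' | h'
        exacts [hs.ne h', lt_asymm hs (haF s h')]
      · rw [← hagree y z s hyz, hya]
      · rw [← hagree y z s (hyz.trans hs), ← hagree x y s (hxy.trans_lt hs), hx,
          Function.update_of_ne hs.ne']
  refine ⟨Φ, hdist, Set.Subset.antisymm ?_ ?_⟩
  · rintro _ ⟨x, rfl⟩
    refine ⟨hΦR x, fun ε hε => (hN.finite x ε hε).subset ?_⟩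
    rintro r ⟨hr, h⟩
    obtain ⟨h1, h2⟩ := hΦR x r h
    exact ⟨h1, hr, fun h' => h ((hΦN x r h1 h2).2 h')⟩
  · rintro f ⟨hfR, hffin⟩
    let ε : ℕ → ℝ := fun n => 1 / ((n : ℝ) + 1)
    have hε : ∀ n, 0 < ε n := fun n => Nat.one_div_pos_of_nat
    have hεlim : Tendsto ε atTop (𝓝 0) := tendsto_one_div_add_atTop_nhds_zero_nat
    -- A general `f` is the limit of its cut-offs at `ε n`; these form a Cauchy sequence with
    -- supports inside that of `f`, so the restricted completeness of a center system applies.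
    have hu : ∀ n, ∃ x, Φ x = fun r => if ε n ≤ r then f r else 0 := fun n => by
      refine hfinite (hffin _ (hε n)).toFinset _ fun r hr => ?_
      by_cases h : ε n ≤ r
      · rw [if_pos h] at hr
        exact ⟨by simpa using ⟨h, hr⟩, hfR r hr⟩
      · exact absurd (if_neg h) hr
    choose u hu using hu
    have hεanti : Antitone ε := fun m n hmn => Nat.one_div_le_one_div hmn
    have hud : ∀ N m n, N ≤ m → N ≤ n → dist (u m) (u n) ≤ ε N := by
      intro N m n hm hn
      rw [hdist _ _ _ (hε N).le]
      intro s hs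
      rw [hu, hu]
      simp only [if_pos ((hεanti hm).trans hs.le), if_pos ((hεanti hn).trans hs.le)]
    have hcauchy : CauchySeq u := cauchySeq_of_le_tendsto_0 ε
      (fun n m N hn hm => hud N n m hn hm) hεlim
    have hS : {0} ∪ {r | f r ≠ 0} ∈ tenuousSubsets R := by
      rw [mem_tenuousSubsets]
      refine ⟨⟨?_, Or.inl rfl⟩, fun δ hδ => (hffin δ hδ).subset ?_, ?_⟩
      · rintro r (rfl | hr)
        exacts [Set.mem_Ici.2 le_rfl, (hfR r hr).2.le]
      · rintro r ⟨rfl | hr, hr'⟩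
        exacts [absurd hr' (not_le.2 hδ), ⟨hr', hr⟩]
      · rintro r (rfl | hr)
        exacts [hR.2, (hfR r hr).1]
    obtain ⟨x, hx⟩ := hN.complete u hcauchy _ hS fun n r hr hr0 hnN => Or.inr fun hfr => by
      refine hnN ((hΦN _ r hr hr0).1 ?_)
      rw [hu]
      simp [hfr]
    refine ⟨x, funext fun s => ?_⟩
    rcases le_or_gt s 0 with hs | hs
    · rw [not_not.1 fun h => not_lt.2 hs (hΦR x s h).2, not_not.1 fun h => not_lt.2 hs (hfR s h).2]
    · have h1 : ∀ᶠ n in atTop, dist (u n) x < s := Metric.tendsto_nhds.1 hx s hs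
      have h2 : ∀ᶠ n in atTop, ε n < s := hεlim.eventually (gt_mem_nhds hs)
      obtain ⟨n, hn1, hn2⟩ := (h1.and h2).exists
      rw [← hagree _ _ s hn1, hu]
      exact if_pos hn2.le

end IsCenterSystem

/-! ### Separable spaces -/

theorem IsSeparableUrysohn.exists_isCenterSystem {R : Set ℝ} (hR : IsRangeSet R) {X : Type*}
    [MetricSpace X] (hX : IsSeparableUrysohn R X) : ∃ N, IsCenterSystem R X N := by
  classical
  have := hX.ultrametric
  have := hX.separable
  have := hX.complete
  have := hX.injective.1
  let u := TopologicalSpace.denseSeq X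
  have hu : ∀ x : X, ∀ ε, 0 < ε → ∃ n, dist x (u n) < ε := fun x ε hε =>
    (TopologicalSpace.denseRange_denseSeq X).exists_dist_lt x hε
  have htri := fun x y z : X => IsUltrametricDist.dist_triangle_max x y z
  -- The first term of `u` in the closed `r`-ball of `x` lies in the open one.
  refine ⟨fun x r => ∃ n, dist x (u n) < r ∧ ∀ m < n, r < dist x (u m), ?_, ?_, ?_, ?_, ?_, ?_, ?_⟩
  · rintro x y r - ⟨n, hn, hm⟩ hxy
    refine ⟨n, ?_, fun m hmn => ?_⟩
    · rw [dist_comm] at hxy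
      exact (htri y x _).trans_lt (max_lt hxy hn)
    · by_contra! h
      exact absurd (hm m hmn) (not_lt.2 ((htri x y _).trans (max_le hxy.le h)))
  · rintro x y r - - ⟨n, hn, hm⟩ ⟨n', hn', hm'⟩ hxy
    have hyx : dist y x ≤ r := by rwa [dist_comm]
    obtain rfl : n = n' := by
      rcases lt_trichotomy n n' with h | h | h
      · exact absurd (hm' n h) (not_lt.2 ((htri y x _).trans (max_le hyx hn.le)))
      · exact h
      · exact absurd (hm n' h) (not_lt.2 ((htri x y _).trans (max_le hxy hn'.le)))
    rw [dist_comm] at hn'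
    exact (htri x _ y).trans_lt (max_lt hn hn')
  · intro x ε hε
    obtain ⟨n₀, hn₀⟩ := hu x ε hε
    refine ((Set.finite_Iic n₀).image fun n => dist x (u n)).subset ?_
    -- If the open ball is not distinguished, the first term in the closed ball is at distance
    -- exactly `r`, and its index is at most `n₀`.
    rintro r ⟨-, hεr, hr⟩
    have hex : ∃ n, dist x (u n) ≤ r := ⟨n₀, hn₀.le.trans hεr⟩
    refine ⟨Nat.find hex, Nat.find_min' hex (hn₀.le.trans hεr), ?_⟩
    by_contra hne
    exact hr ⟨Nat.find hex, lt_of_le_of_ne (Nat.find_spec hex) hne,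
      fun m hm => not_le.1 (Nat.find_min hex hm)⟩
  · intro x I hI
    by_cases h : ∃ r ∈ I, 0 < r
    · obtain ⟨r, hr, hr0⟩ := h
      -- The truncation is the first term of `u` whose distance to `x` lies in `I`.
      have hex : ∃ n, dist x (u n) ∈ I := by
        obtain ⟨n, hn⟩ := hu x r hr0
        exact ⟨n, hI hn.le hr⟩
      refine ⟨u (Nat.find hex), fun s hs _ hs0 => ⟨Nat.find hex, by simpa using hs0,
        fun m hm => ?_⟩, Or.inr (Nat.find_spec hex)⟩
      by_contra! hle
      refine Nat.find_min hex hm (hI (htri x (u (Nat.find hex)) (u m)) ?_)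
      rcases max_choice (dist x (u (Nat.find hex))) (dist (u (Nat.find hex)) (u m)) with h | h <;>
        rw [h]
      exacts [Nat.find_spec hex, hI hle hs]
    · exact ⟨x, fun s hs _ hs0 => absurd ⟨s, hs, hs0⟩ h, Or.inl (dist_self x)⟩
  · refine fun x r _ hr0 => ⟨Set.range u, Set.countable_range u, fun y _ => ?_⟩
    obtain ⟨n, hn⟩ := hu y r hr0
    exact ⟨u n, ⟨n, rfl⟩, hn⟩
  · exact hX.injective.hasEquilateral hR
  · exact fun v hv _ _ _ => cauchySeq_tendsto_of_complete hv

/-! ### Petaloid spaces -/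

theorem exists_pos_ne_of_not_countable {R : Set ℝ} (hR : IsRangeSet R) (hc : ¬ R.Countable)
    (r : ℝ) : ∃ s ∈ R, 0 < s ∧ s ≠ r := by
  by_contra! h
  refine hc ((Set.toFinite {0, r}).countable.mono fun s hs => ?_)
  rcases (Set.mem_Ici.1 (hR.1 hs)).eq_or_lt with h0 | h0
  · exact Or.inl h0.symm
  · exact Or.inr (h s hs h0)

namespace IsPetal

variable {R : Set ℝ} {X : Type*} [MetricSpace X] {P : Set ℝ → Set X}

theorem urysohn_insert (hP : IsPetal R P) (hR : IsRangeSet R) {S : Set ℝ}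
    (hS : S ∈ tenuousSubsets R) {r : ℝ} (hr : r ∈ R) (hr0 : 0 < r) :
    IsSeparableUrysohn (insert r S) (P (insert r S)) :=
  hP.urysohn _ (insert_mem_tenuousSubsets hR hS hr) fun h =>
    hr0.ne' (show r ∈ ({0} : Set ℝ) from h ▸ Set.mem_insert r S)

/-- (P1) says nothing about `P {0}`; writing `P S` as an intersection of two pieces with larger
index sets makes closedness and the values of distances available for every `S`. -/
theorem inter_insert (hP : IsPetal R P) (hR : IsRangeSet R) {S : Set ℝ}
    (hS : S ∈ tenuousSubsets R) {r s : ℝ} (hr : r ∈ R) (hs : s ∈ R) (hrs : r ≠ s) :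
    P (insert r S) ∩ P (insert s S) = P S := by
  rw [hP.inter _ (insert_mem_tenuousSubsets hR hS hr) _ (insert_mem_tenuousSubsets hR hS hs)]
  congr 1
  ext x
  simp only [Set.mem_inter_iff, Set.mem_insert_iff]
  refine ⟨?_, fun h => ⟨Or.inr h, Or.inr h⟩⟩
  rintro ⟨rfl | h, h' | h'⟩
  exacts [absurd h' hrs, h', h, h]

theorem isClosed (hP : IsPetal R P) (hR : IsRangeSet R) (hc : ¬ R.Countable) {S : Set ℝ}
    (hS : S ∈ tenuousSubsets R) : IsClosed (P S) := by
  obtain ⟨r, hr, hr0, -⟩ := exists_pos_ne_of_not_countable hR hc 0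
  obtain ⟨s, hs, hs0, hsr⟩ := exists_pos_ne_of_not_countable hR hc r
  rw [← hP.inter_insert hR hS hr hs hsr.symm]
  exact (completeSpace_coe_iff_isComplete.1 (hP.urysohn_insert hR hS hr hr0).complete).isClosed.inter
    (completeSpace_coe_iff_isComplete.1 (hP.urysohn_insert hR hS hs hs0).complete).isClosed

theorem dist_mem (hP : IsPetal R P) (hR : IsRangeSet R) (hc : ¬ R.Countable) {S : Set ℝ}
    (hS : S ∈ tenuousSubsets R) {x y : X} (hx : x ∈ P S) (hy : y ∈ P S) : dist x y ∈ S := by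
  obtain ⟨r, hr, hr0, -⟩ := exists_pos_ne_of_not_countable hR hc 0
  obtain ⟨s, hs, hs0, hsr⟩ := exists_pos_ne_of_not_countable hR hc r
  have key : ∀ r ∈ R, 0 < r → dist x y = r ∨ dist x y ∈ S := fun r hr hr0 =>
    have hsub := hP.mono hS (insert_mem_tenuousSubsets hR hS hr) (Set.subset_insert r S)
    (hP.urysohn_insert hR hS hr hr0).valued ⟨x, hsub hx⟩ ⟨y, hsub hy⟩
  rcases key r hr hr0 with h | h
  · rcases key s hs hs0 with h' | h'
    exacts [absurd (h'.symm.trans h) hsr, h']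
  · exact h

/-- The distance from a point to a piece of a petal is attained. -/
theorem exists_infDist_eq_dist (hP : IsPetal R P) (hR : IsRangeSet R) (hc : ¬ R.Countable)
    {S T : Set ℝ} (hS : S ∈ tenuousSubsets R) (hT : T ∈ tenuousSubsets R) {x : X} (hx : x ∈ P T) :
    ∃ p ∈ P S, Metric.infDist x (P S) = dist x p := by
  obtain ⟨hne, hd⟩ := hP.distance S hS T hT x hx
  by_cases h0 : Metric.infDist x (P S) = 0
  · refine ⟨x, ?_, by rw [h0, dist_self]⟩
    exact ((hP.isClosed hR hc hS).mem_iff_infDist_zero hne).2 h0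
  have hpos : 0 < Metric.infDist x (P S) := lt_of_le_of_ne Metric.infDist_nonneg (Ne.symm h0)
  have hST := union_mem_tenuousSubsets hS hT
  have hfin : ((fun p => dist x p) '' P S).Finite := by
    refine ((mem_tenuousSubsets.1 hST).2.1 _ hpos).subset ?_
    rintro _ ⟨p, hp, rfl⟩
    exact ⟨hP.dist_mem hR hc hST (hP.mono hT hST Set.subset_union_right hx)
      (hP.mono hS hST Set.subset_union_left hp), Metric.infDist_le_dist_of_mem hp⟩
  obtain ⟨p, hp, h⟩ := (hne.image fun p => dist x p).csInf_mem hfin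
  exact ⟨p, hp, by rw [Metric.infDist_eq_iInf, ← sInf_image', ← h]⟩

theorem exists_isCenterSystem (hP : IsPetal R P) (hR : IsRangeSet R) (hc : ¬ R.Countable) :
    ∃ N, IsCenterSystem R X N := by
  have hball : ∀ x, ∀ r ∈ R, 0 < r → ∃ T ∈ tenuousSubsets R, r ∈ T ∧ x ∈ P T ∧
      IsSeparableUrysohn T (P T) := fun x r hr hr0 => by
    obtain ⟨T, hT, hx⟩ := hP.exists_mem x
    have hT' := insert_mem_tenuousSubsets hR hT hr
    exact ⟨_, hT', Set.mem_insert r T, hP.mono hT hT' (Set.subset_insert r T) hx,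
      hP.urysohn_insert hR hT hr hr0⟩
  refine ⟨fun x r => ∃ S ∈ tenuousSubsets R, x ∈ P S ∧ r ∉ S, ?_, ?_, ?_, ?_, ?_, ?_, ?_⟩
  · rintro x y r hr ⟨S, hS, hx, hrS⟩ hxy
    obtain ⟨T, hT, hy⟩ := hP.exists_mem y
    have hr0 : r ≠ 0 := fun h => hrS (h ▸ hS.1.2)
    -- By (P4) the distance from `y` to this piece is `0` or `r`; it is below `r` because `x`
    -- belongs to the piece.
    have hW : (S ∪ T) \ {r} ∈ tenuousSubsets R :=
      tenuousSubsets_mono (union_mem_tenuousSubsets hS hT) Set.sdiff_subset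
        ⟨Or.inl hS.1.2, hr0.symm⟩
    have hxW : x ∈ P ((S ∪ T) \ {r}) :=
      hP.mono hS hW (fun s hs => ⟨Or.inl hs, fun h => hrS (h ▸ hs)⟩) hx
    have hle := Metric.infDist_le_dist_of_mem (x := y) hxW
    rw [dist_comm y x] at hle
    obtain ⟨hne, hd⟩ := hP.distance _ hW T hT y hy
    refine ⟨_, hW, ((hP.isClosed hR hc hW).mem_iff_infDist_zero hne).2 ?_, fun h => h.2 rfl⟩
    rcases hd with h | ⟨h, h'⟩
    · exact h
    · exact absurd ⟨Or.inr h, (hle.trans_lt hxy).ne⟩ h'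
  · rintro x y r hr - ⟨S, hS, hx, hrS⟩ ⟨T, hT, hy, hrT⟩ hxy
    have hST := union_mem_tenuousSubsets hS hT
    refine lt_of_le_of_ne hxy fun h => ?_
    have := hP.dist_mem hR hc hST (hP.mono hS hST Set.subset_union_left hx)
      (hP.mono hT hST Set.subset_union_right hy)
    rw [h] at this
    exact this.elim hrS hrT
  · intro x ε hε
    obtain ⟨T, hT, hx⟩ := hP.exists_mem x
    refine ((mem_tenuousSubsets.1 hT).2.1 ε hε).subset ?_
    rintro r ⟨-, hr, h⟩
    exact ⟨by_contra fun h' => h ⟨T, hT, hx, h'⟩, hr⟩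
  · intro x I _
    obtain ⟨T, hT, hx⟩ := hP.exists_mem x
    -- The truncation is a nearest point of this piece; by (P4) its distance to `x` is `0` or lies
    -- in `I`.
    have hS : {0} ∪ (T \ I) ∈ tenuousSubsets R :=
      tenuousSubsets_mono hT (Set.union_subset (Set.singleton_subset_iff.2 hT.1.2) Set.sdiff_subset)
        (Or.inl rfl)
    obtain ⟨p, hp, hd⟩ := hP.exists_infDist_eq_dist hR hc hS hT hx
    refine ⟨p, fun s hs _ hs0 => ⟨_, hS, hp, ?_⟩, ?_⟩
    · rintro (h | h)
      exacts [hs0.ne' h, h.2 hs]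
    · rw [← hd]
      rcases (hP.distance _ hS T hT x hx).2 with h | ⟨h, h'⟩
      · exact Or.inl h
      · exact Or.inr (by_contra fun hI => h' (Or.inr ⟨h, hI⟩))
  · intro x r hr hr0
    obtain ⟨T, hT, hrT, hx, hU⟩ := hball x r hr hr0
    have := hU.separable
    obtain ⟨D, hD, hDd⟩ := TopologicalSpace.exists_countable_dense (P T)
    refine ⟨Subtype.val '' D, hD.image _, fun y hxy => ?_⟩
    obtain ⟨T', hT', hy⟩ := hP.exists_mem y
    obtain ⟨hne, hd⟩ := hP.distance T hT T' hT' y hy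
    have hle := Metric.infDist_le_dist_of_mem (x := y) hx
    rw [dist_comm y x] at hle
    -- As `r ∈ T`, (P4) excludes the value `r`, so the separable piece `P T` meets every open
    -- `r`-ball inside the closed one.
    have hlt : Metric.infDist y (P T) < r := by
      rcases hd with h | ⟨-, h⟩
      · rw [show Metric.infDist y (P T) = 0 from h]; exact hr0
      · exact lt_of_le_of_ne (hle.trans hxy) fun h' => h (h' ▸ hrT)
    obtain ⟨p, hp, hyp⟩ := (Metric.infDist_lt_iff hne).1 hlt
    obtain ⟨d, hd, hpd⟩ := hDd.exists_dist_lt (⟨p, hp⟩ : P T) (sub_pos.2 hyp)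
    refine ⟨d, ⟨d, hd, rfl⟩, ?_⟩
    rw [Subtype.dist_eq] at hpd
    linarith [dist_triangle y p d]
  · intro x r hr hr0 n
    obtain ⟨T, hT, hrT, hx, hU⟩ := hball x r hr hr0
    obtain ⟨g, hg, hgd⟩ := hU.injective.hasEquilateral hT.1 ⟨x, hx⟩ r hrT hr0 n
    exact ⟨fun i => g i, hg, hgd⟩
  · intro u hu S hS huS
    -- A positive distance from `u n` to `P S` would belong to every `T` with `u n ∈ P T`, so it
    -- would be a radius outside `N`, hence in `S`, against (P4). The sequence thus stays in one
    -- piece, where completeness is known.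
    have hmem : ∀ n, u n ∈ P S := fun n => by
      obtain ⟨T, hT, hx⟩ := hP.exists_mem (u n)
      obtain ⟨hne, hd⟩ := hP.distance S hS T hT _ hx
      refine ((hP.isClosed hR hc hS).mem_iff_infDist_zero hne).2 ?_
      rcases hd with h | ⟨hT1, hS1⟩
      · exact h
      by_contra h0
      refine hS1 (huS n _ (hT.2.2 hT1)
        (lt_of_le_of_ne Metric.infDist_nonneg (Ne.symm h0)) ?_)
      rintro ⟨T', hT', hx', hn⟩
      rcases (hP.distance S hS T' hT' _ hx').2 with h | ⟨h, -⟩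
      exacts [h0 h, hn h]
    obtain ⟨r, hr, hr0, -⟩ := exists_pos_ne_of_not_countable hR hc 0
    have hcomp := completeSpace_coe_iff_isComplete.1 (hP.urysohn_insert hR hS hr hr0).complete
    obtain ⟨x, -, hx⟩ := cauchySeq_tendsto_of_isComplete hcomp
      (fun n => hP.mono hS (insert_mem_tenuousSubsets hR hS hr) (Set.subset_insert r S) (hmem n)) hu
    exact ⟨x, hx⟩

end IsPetal

/-! ### Universal spaces and their squares -/

theorem IsPetaloid.prod {R : Set ℝ} {X : Type*} [MetricSpace X] (hX : IsPetaloid R X) :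
    IsPetaloid R (X × X) := by
  have := hX.ultrametric
  obtain ⟨P, hP⟩ := hX.exists_petal
  exact ⟨IsUltrametricDist.prod, hX.valued.prod hX.valued, _, hP.prod⟩

theorem IsUrysohnUniversal.prod {R : Set ℝ} (hR : IsRangeSet R) {X : Type*} [MetricSpace X]
    (hX : IsUrysohnUniversal R X) : IsUrysohnUniversal R (X × X) :=
  hX.imp (And.imp_right fun h => h.prod hR h) (And.imp_right IsPetaloid.prod)

theorem IsUrysohnUniversal.exists_isCoordinateSystem {R : Set ℝ} (hR : IsRangeSet R) {X : Type*}
    [MetricSpace X] (hX : IsUrysohnUniversal R X) : ∃ Φ, IsCoordinateSystem R X Φ := by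
  rcases hX with ⟨-, hX⟩ | ⟨hc, hX⟩
  · have := hX.ultrametric
    have := hX.injective.1
    obtain ⟨N, hN⟩ := hX.exists_isCenterSystem hR
    exact hN.exists_isCoordinateSystem hR hX.valued
  · have := hX.ultrametric
    obtain ⟨P, hP⟩ := hX.exists_petal
    obtain ⟨r, hr, hr0, -⟩ := exists_pos_ne_of_not_countable hR hc 0
    have : Nonempty X := (hP.urysohn_insert hR (pair_mem_tenuousSubsets hR hr) hr
      hr0).injective.1.map Subtype.val
    obtain ⟨N, hN⟩ := hP.exists_isCenterSystem hR hc
    exact hN.exists_isCoordinateSystem hR hX.valued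

theorem mainTheorem2 {X : Type*} [MetricSpace X] (R : Set ℝ) (hR : IsRangeSet R)
    (hX : IsUrysohnUniversal R X) :
    IsUrysohnUniversal R (X × X) ∧
      Nonempty (X × X ≃ᵢ X) ∧
      (¬ R.Countable → ∀ P : Set ℝ → Set X, IsPetal R P →
        IsPetal R (fun S => P S ×ˢ P S)) := by
  obtain ⟨Φ, hΦ⟩ := (hX.prod hR).exists_isCoordinateSystem hR
  obtain ⟨Ψ, hΨ⟩ := hX.exists_isCoordinateSystem hR
  exact ⟨hX.prod hR, hΦ.nonempty_isometryEquiv hΨ, fun _ P hP => hP.prod⟩
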